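/- Let $X$ and $Y$ be finite $T_0$-spaces. For a finite $T_0$-space $X$, order $X$ by $x\le y$ iff $x$ lies in every open set containing $y$, and let $\mathcal{K}(X)$ be the finite simplicial complex whose simplices are the non-empty chains of $X$. A continuous map $f:X\to Y$ is order preserving and induces a simplicial map $\mathcal{K}(f):\mathcal{K}(X)\to\mathcal{K}(Y)$, equal to $f$ on vertices, and hence a continuous map $|\mathcal{K}(f)|:|\mathcal{K}(X)|\to|\mathcal{K}(Y)|$ between the geometric realizations. For finite simplicial complexes $L\subseteq K$, there is an elementary collapse from $K$ to $L$ if there are a simplex $S$ of $K$ and a vertex $a\notin S$ of $K$ with $K=L\cup aS$ and $L\cap aS=a\dot S$, where $aS$ is the simplex spanned by $a$ and $S$ (with all its faces), $\dot S$ is the boundary of $S$ and $a\dot S$ is the cone on it with apex $a$; $K$ collapses to $L$ if there is a finite (possibly empty) sequence of elementary collapses from $K$ to $L$. An expansion is the map $|L|\to|K|$ induced by a simplicial isomorphism of $L$ onto a subcomplex to which $K$ collapses. A homotopy equivalence $g:|K|\to|L|$ between realizations of finite simplicial complexes is a simple homotopy equivalence if it is homotopic to a composition of a finite sequence of maps $|K|\to|K_1|\to\cdots\to|K_n|\to|L|$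 (all $K_i$ finite simplicial complexes), each of them an expansion or a homotopy inverse of one. Theorem. If $f:X\to Y$ is a homotopy equivalence between finite $T_0$-spaces, then $|\mathcal{K}(f)|:|\mathcal{K}(X)|\to|\mathcal{K}(Y)|$ is a simple homotopy equivalence. -/

import Mathlib

universe u v

namespace SimpleHomotopy

/-! ### Finite simplicial complexes and collapses

A finite simplicial complex is a `PreAbstractSimplicialComplex V` on a finite type `V`: a set of
non-empty finite subsets of `V` that is closed under passing to non-empty subsets.  Its vertices are
the `v : V` such that `{v}` is a face; they need not exhaust `V`. -/

/-- The complex formed by a simplex `S` and all its (non-empty) faces. -/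
def fullSimplex {V : Type u} (S : Finset V) : PreAbstractSimplicialComplex V where
  faces := {T | T.Nonempty ∧ T ⊆ S}
  isRelLowerSet_faces := fun _ hT => ⟨hT.1, fun _ hUT hU => ⟨hU, hUT.trans hT.2⟩⟩

/-- The boundary of a simplex `S`: all its (non-empty) proper faces. -/
def boundary {V : Type u} (S : Finset V) : PreAbstractSimplicialComplex V where
  faces := {T | T.Nonempty ∧ T ⊂ S}
  isRelLowerSet_faces := fun _ hT =>
    ⟨hT.1, fun _ hUT hU => ⟨hU, Finset.ssubset_of_subset_of_ssubset hUT hT.2⟩⟩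

open scoped Classical in
/-- The cone `aK` on `K` with apex `a` (used when `a` is not a vertex of `K`): its simplices are
`{a}`, the simplices `T` of `K`, and the sets `T ∪ {a}` with `T` a simplex of `K`. -/
noncomputable def cone {V : Type u} (a : V) (K : PreAbstractSimplicialComplex V) :
    PreAbstractSimplicialComplex V where
  faces := {T | T.Nonempty ∧ ((T.erase a).Nonempty → T.erase a ∈ K.faces)}
  isRelLowerSet_faces := fun _ hT =>
    ⟨hT.1, fun _ hUT hU => ⟨hU, fun hne =>
      (K.isRelLowerSet_faces (hT.2 (hne.mono (Finset.erase_subset_erase a hUT)))).2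
        (Finset.erase_subset_erase a hUT) hne⟩⟩

open scoped Classical in
/-- There is an elementary simplicial collapse from `K` to `L`: there are a simplex `S` of `K` and
a vertex `a` of `K` not in `S` with `K = L ∪ aS` and `L ∩ aS = a∂S`. -/
def ElementaryCollapse {V : Type u} (K L : PreAbstractSimplicialComplex V) : Prop :=
  ∃ (S : Finset V) (a : V), S ∈ K.faces ∧ {a} ∈ K.faces ∧ a ∉ S ∧
    K = L ⊔ fullSimplex (insert a S) ∧
    L ⊓ fullSimplex (insert a S) = cone a (boundary S)

/-- `K` collapses to `L`: there is a finite (possibly empty) sequence of elementary collapses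
from `K` to `L`. -/
def Collapses {V : Type u} (K L : PreAbstractSimplicialComplex V) : Prop :=
  Relation.ReflTransGen ElementaryCollapse K L

/-! ### Simplicial maps and geometric realization -/

open scoped Classical in
/-- A simplicial map: a map of vertices that sends simplices onto simplices. -/
structure SimplicialMap {V : Type u} {W : Type v} (K : PreAbstractSimplicialComplex V)
    (L : PreAbstractSimplicialComplex W) where
  toFun : V → W
  image_mem : ∀ S ∈ K.faces, S.image toFun ∈ L.faces

/-- The geometric realization `|K|` of a finite simplicial complex in barycentric coordinates:
the points of the standard simplex on `V` whose support is a simplex of `K`, with the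
subspace topology. -/
abbrev Realization {V : Type u} [Fintype V] (K : PreAbstractSimplicialComplex V) : Type u :=
  {t : stdSimplex ℝ V // Finset.univ.filter (fun v => t v ≠ 0) ∈ K.faces}

theorem support_map_mem {V : Type u} {W : Type v} [Fintype V] [Fintype W]
    {K : PreAbstractSimplicialComplex V} {L : PreAbstractSimplicialComplex W}
    (φ : SimplicialMap K L) (t : Realization K) :
    Finset.univ.filter (fun w => stdSimplex.map φ.toFun t.1 w ≠ 0) ∈ L.faces := by
  classical
  have key : Finset.univ.filter (fun w => stdSimplex.map φ.toFun t.1 w ≠ 0) =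
      (Finset.univ.filter (fun v => t.1 v ≠ 0)).image φ.toFun := by
    ext w
    simp only [Finset.mem_filter, Finset.mem_univ, true_and, Finset.mem_image,
      stdSimplex.map_coe, FunOnFinite.linearMap_apply_apply]
    have h0 := Finset.sum_eq_zero_iff_of_nonneg (s := Finset.univ.filter (fun v => φ.toFun v = w))
      (f := fun v => t.1 v) (fun v _ => t.1.2.1 v)
    refine (not_congr h0).trans ?_
    simp only [Finset.mem_filter, Finset.mem_univ, true_and]
    push Not
    exact ⟨fun ⟨v, h1, h2⟩ => ⟨v, h2, h1⟩, fun ⟨v, h1, h2⟩ => ⟨v, h2, h1⟩⟩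
  rw [key]
  convert! φ.image_mem _ t.2

/-- The map `|φ| : |K| → |L|` induced by a simplicial map `φ`: it is `φ` on vertices and
affine on every simplex. -/
noncomputable def SimplicialMap.realize {V : Type u} {W : Type v} [Fintype V] [Fintype W]
    {K : PreAbstractSimplicialComplex V} {L : PreAbstractSimplicialComplex W}
    (φ : SimplicialMap K L) : C(Realization K, Realization L) where
  toFun t := ⟨stdSimplex.map φ.toFun t.1, support_map_mem φ t⟩
  continuous_toFun :=
    ((stdSimplex.continuous_map φ.toFun).comp continuous_subtype_val).subtype_mk _

open scoped Classical in
/-- A simplicial map `φ : K → L` is a (simplicial) expansion if it is injective on the vertices of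
`K`, so that it identifies `K` with a subcomplex `φ(K)` of `L`, and `L` collapses to `φ(K)`. -/
def SimplicialMap.IsExpansion {V : Type u} {W : Type v} {K : PreAbstractSimplicialComplex V}
    {L : PreAbstractSimplicialComplex W} (φ : SimplicialMap K L) : Prop :=
  Set.InjOn φ.toFun {v | {v} ∈ K.faces} ∧ Collapses L (K.map φ.toFun)

/-! ### Simple homotopy equivalences -/

/-- `g` is a homotopy inverse of `f`. -/
def IsHomotopyInverse {A : Type u} {B : Type v} [TopologicalSpace A] [TopologicalSpace B]
    (f : C(A, B)) (g : C(B, A)) : Prop :=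
  (g.comp f).Homotopic (ContinuousMap.id A) ∧ (f.comp g).Homotopic (ContinuousMap.id B)

/-- `f` is a homotopy equivalence. -/
def IsHomotopyEquivalence {A : Type u} {B : Type v} [TopologicalSpace A] [TopologicalSpace B]
    (f : C(A, B)) : Prop :=
  ∃ g : C(B, A), IsHomotopyInverse f g

/-- The maps `|K| → |K₁| → ⋯ → |Kₙ| → |L|` which are compositions of finite sequences of maps, each
of them (the realization of) an expansion or a homotopy inverse of one. -/
inductive IsDeformation : ∀ {V W : Type u} [Fintype V] [Fintype W]
    {K : PreAbstractSimplicialComplex V} {L : PreAbstractSimplicialComplex W},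
    C(Realization K, Realization L) → Prop
  | expansion {V W : Type u} [Fintype V] [Fintype W]
      {K : PreAbstractSimplicialComplex V} {L : PreAbstractSimplicialComplex W}
      (φ : SimplicialMap K L) (hφ : φ.IsExpansion) : IsDeformation φ.realize
  | homotopyInverse {V W : Type u} [Fintype V] [Fintype W]
      {K : PreAbstractSimplicialComplex V} {L : PreAbstractSimplicialComplex W}
      (φ : SimplicialMap K L) (hφ : φ.IsExpansion) (r : C(Realization L, Realization K))
      (hr : IsHomotopyInverse φ.realize r) : IsDeformation r
  | comp {V W Z : Type u} [Fintype V] [Fintype W] [Fintype Z]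
      {K : PreAbstractSimplicialComplex V} {L : PreAbstractSimplicialComplex W}
      {M : PreAbstractSimplicialComplex Z}
      {f : C(Realization K, Realization L)} {g : C(Realization L, Realization M)}
      (hf : IsDeformation f) (hg : IsDeformation g) : IsDeformation (g.comp f)

/-- A map `f : |K| → |L|` is a simple homotopy equivalence if it is a homotopy equivalence that is
homotopic to a composition of finitely many expansions and homotopy inverses of expansions. -/
def IsSimpleHomotopyEquivalence {V W : Type u} [Fintype V] [Fintype W]
    {K : PreAbstractSimplicialComplex V} {L : PreAbstractSimplicialComplex W}
    (f : C(Realization K, Realization L)) : Prop :=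
  IsHomotopyEquivalence f ∧
    ∃ d : C(Realization K, Realization L), IsDeformation d ∧ f.Homotopic d

/-! ### The order complex of a finite T₀-space -/

/-- The complex `K(X)` of a finite T₀-space `X`: its simplices are the non-empty chains of `X` for
the order `x ≤ y ↔ x ∈ U_y`, where `U_y` is the intersection of all open sets containing `y`;
in Mathlib's notation `x ∈ U_y` reads `x ⤳ y`. -/
def orderComplex (X : Type u) [TopologicalSpace X] : PreAbstractSimplicialComplex X where
  faces := {S | S.Nonempty ∧ IsChain (fun x y : X => x ⤳ y) (S : Set X)}
  isRelLowerSet_faces := fun _ hS =>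
    ⟨hS.1, fun _ hTS hT => ⟨hT, hS.2.mono (Finset.coe_subset.2 hTS)⟩⟩

/-- The simplicial map `K(f) : K(X) → K(Y)` that coincides with `f` on vertices. -/
def orderComplexMap {X : Type u} {Y : Type v} [TopologicalSpace X] [TopologicalSpace Y]
    (f : C(X, Y)) : SimplicialMap (orderComplex X) (orderComplex Y) where
  toFun := f
  image_mem := by
    classical
    rintro S ⟨hne, hS⟩
    refine ⟨hne.image f, ?_⟩
    rintro _ hx _ hy hxy
    simp only [Finset.coe_image, Set.mem_image, Finset.mem_coe] at hx hy
    obtain ⟨x, hx, rfl⟩ := hx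
    obtain ⟨y, hy, rfl⟩ := hy
    have hne' : x ≠ y := fun h => hxy (congrArg f h)
    exact (hS hx hy hne').imp (fun h => h.map f.continuous) (fun h => h.map f.continuous)

end SimpleHomotopy

namespace SimpleHomotopy

/-! Stong's classification reduces the theorem to deleting beat points. If `x` is a beat point
witnessed by `p`, everything comparable with `x` is comparable with `p`, so the link of `x` in the
order complex is a cone with apex `p`, and the complex collapses to the deletion of `x`
(`collapses_deletion`). Hence the inclusion of the complement of `x` realizes to an expansion, and
the retraction sending `x` to `p` realizes to a homotopy inverse of it
(`IsBeatPoint.realize_isHomotopyInverse`).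

Deleting beat points on either side of `f` changes its realization only by such maps. Once none are
left, any self-map homotopic to the identity is the identity (`eq_id_of_homotopic_id`), so a
homotopy equivalence is a homeomorphism and induces a simplicial isomorphism. -/

/-! ### Collapsing the star of a vertex whose link is a cone -/

/-- The subcomplex of simplices that do not contain the vertex `x`. -/
def deletion {V : Type u} (K : PreAbstractSimplicialComplex V) (x : V) :
    PreAbstractSimplicialComplex V where
  faces := {T | T ∈ K.faces ∧ x ∉ T}
  isRelLowerSet_faces := fun _ hT =>
    ⟨(K.isRelLowerSet_faces hT.1).1, fun _ hUT hU =>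
      ⟨(K.isRelLowerSet_faces hT.1).2 hUT hU, fun hx => hT.2 (hUT hx)⟩⟩

open scoped Classical in
/-- If the link of `x` in `K` is a cone with apex `p`, then `K` collapses to the deletion of `x`. -/
theorem collapses_deletion {V : Type u} [Finite V] (K : PreAbstractSimplicialComplex V) {x p : V}
    (hpx : p ≠ x) (h : ∀ S ∈ K.faces, x ∈ S → insert p S ∈ K.faces) :
    Collapses K (deletion K x) := by
  induction hn : K.faces.ncard using Nat.strong_induction_on generalizing K with
  | _ n ih =>
  have lower : ∀ {S T : Finset V}, S ∈ K.faces → T ⊆ S → T.Nonempty → T ∈ K.faces :=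
    fun hS hTS hT => (K.isRelLowerSet_faces hS).2 hTS hT
  by_cases hB : ∃ S, S ∈ K.faces ∧ x ∈ S ∧ p ∉ S
  -- By maximality the only simplices containing `S` are `S` and `insert p S`, so `S` is a free face
  -- and the pair can be collapsed with apex `p`.
  · obtain ⟨S, ⟨hSK, hxS, hpS⟩, hmax⟩ := Set.Finite.exists_maximal
      (s := {S | S ∈ K.faces ∧ x ∈ S ∧ p ∉ S}) (Set.toFinite _) hB
    have hS' := h S hSK hxS
    have above : ∀ T ∈ K.faces, S ⊆ T → T = S ∨ T = insert p S := by
      intro T hT hST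
      have h1 : S ⊆ T.erase p := Finset.subset_erase.2 ⟨hST, hpS⟩
      have h2 : T.erase p = S := le_antisymm
        (hmax ⟨lower hT (Finset.erase_subset _ _) ⟨x, h1 hxS⟩, h1 hxS,
          Finset.notMem_erase p T⟩ h1) h1
      by_cases hp : p ∈ T
      · exact Or.inr (by rw [← h2, Finset.insert_erase hp])
      · exact Or.inl (by rw [← h2, Finset.erase_eq_of_notMem hp])
    let L : PreAbstractSimplicialComplex V :=
      { faces := {T | T ∈ K.faces ∧ T ≠ S ∧ T ≠ insert p S}
        isRelLowerSet_faces := fun T hT => ⟨(K.isRelLowerSet_faces hT.1).1, fun U hUT hU =>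
          ⟨lower hT.1 hUT hU, by
            rintro rfl
            rcases above T hT.1 hUT with h | h
            exacts [hT.2.1 h, hT.2.2 h], by
            rintro rfl
            rcases above T hT.1 ((Finset.subset_insert _ _).trans hUT) with h | h
            exacts [hT.2.1 h, hT.2.2 h]⟩⟩ }
    have hcone : L ⊓ fullSimplex (insert p S) = cone p (boundary S) := by
      ext T
      change (T ∈ K.faces ∧ T ≠ S ∧ T ≠ insert p S) ∧ (T.Nonempty ∧ T ⊆ insert p S) ↔
        T.Nonempty ∧ ((T.erase p).Nonempty → (T.erase p).Nonempty ∧ T.erase p ⊂ S)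
      constructor
      · rintro ⟨⟨-, h1, h2⟩, h3, h4⟩
        refine ⟨h3, fun h5 => ⟨h5, Finset.ssubset_iff_subset_ne.2
          ⟨Finset.subset_insert_iff.1 h4, fun h6 => ?_⟩⟩⟩
        by_cases hp : p ∈ T
        · exact h2 (by rw [← h6, Finset.insert_erase hp])
        · exact h1 (by rw [← h6, Finset.erase_eq_of_notMem hp])
      · rintro ⟨h1, h2⟩
        have h3 : T.erase p ⊂ S := by
          -- The apex alone, `T = {p}`, lies in the cone even when the boundary of `S` is empty.
          rcases (T.erase p).eq_empty_or_nonempty with h4 | h4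
          · rw [h4]
            exact Finset.empty_ssubset.2 ⟨x, hxS⟩
          · exact (h2 h4).2
        have h4 : T ⊆ insert p S := Finset.subset_insert_iff.2 h3.1
        refine ⟨⟨lower hS' h4 h1, ?_, ?_⟩, h1, h4⟩
        · rintro rfl
          rw [Finset.erase_eq_of_notMem hpS] at h3
          exact h3.ne rfl
        · rintro rfl
          rw [Finset.erase_insert hpS] at h3
          exact h3.ne rfl
    have hunion : K = L ⊔ fullSimplex (insert p S) := by
      ext T
      change T ∈ K.faces ↔ (T ∈ K.faces ∧ T ≠ S ∧ T ≠ insert p S) ∨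
        (T.Nonempty ∧ T ⊆ insert p S)
      constructor
      · intro hT
        by_cases h1 : T ⊆ insert p S
        · exact Or.inr ⟨(K.isRelLowerSet_faces hT).1, h1⟩
        · refine Or.inl ⟨hT, ?_, ?_⟩
          · rintro rfl
            exact h1 (Finset.subset_insert _ _)
          · rintro rfl
            exact h1 subset_rfl
      · rintro (h1 | ⟨h1, h2⟩)
        exacts [h1.1, lower hS' h2 h1]
    have hdel : deletion K x = deletion L x := by
      ext T
      change (T ∈ K.faces ∧ x ∉ T) ↔ (T ∈ K.faces ∧ T ≠ S ∧ T ≠ insert p S) ∧ x ∉ T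
      constructor
      · rintro ⟨h1, h2⟩
        refine ⟨⟨h1, ?_, ?_⟩, h2⟩
        · rintro rfl
          exact h2 hxS
        · rintro rfl
          exact h2 (Finset.mem_insert_of_mem hxS)
      · exact fun h => ⟨h.1.1, h.2⟩
    rw [hdel]
    refine Relation.ReflTransGen.head (b := L) ⟨S, p, hSK,
      lower hS' (by simp) (Finset.singleton_nonempty p), hpS, hunion, hcone⟩
      (ih _ ?_ L ?_ rfl)
    · rw [← hn]
      exact Set.ncard_lt_ncard ⟨fun T hT => hT.1, fun hKL => (hKL hSK).2.1 rfl⟩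
    -- The cone condition survives in `L`: if `insert p T` were a removed simplex, then `T` would be
    -- removed too.
    · rintro T ⟨hT, hTS, hTS'⟩ hxT
      refine ⟨h T hT hxT, fun h1 => hpS (h1 ▸ Finset.mem_insert_self p T), fun h1 => ?_⟩
      have hST : S ⊆ T := fun y hy => by
        have hyT : y ∈ insert p T := h1 ▸ Finset.mem_insert_of_mem hy
        exact (Finset.mem_insert.1 hyT).resolve_left (fun h => hpS (h ▸ hy))
      rcases above T hT hST with h2 | h2
      exacts [hTS h2, hTS' h2]
  -- If every simplex through `x` contains `p`, there is none: erasing `p` from one would leave a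
  -- simplex through `x` without `p`.
  · have : deletion K x = K := by
      ext T
      refine ⟨fun hT => hT.1, fun hT => ⟨hT, fun hxT => hB ⟨T.erase p, ?_, ?_⟩⟩⟩
      · exact lower hT (Finset.erase_subset _ _) ⟨x, Finset.mem_erase.2 ⟨hpx.symm, hxT⟩⟩
      · exact ⟨Finset.mem_erase.2 ⟨hpx.symm, hxT⟩, Finset.notMem_erase p T⟩
    rw [this]
    exact Relation.ReflTransGen.refl

/-! ### Contiguous simplicial maps -/

open scoped Classical in
theorem exists_of_map_ne_zero {V : Type u} {W : Type v} [Fintype V] [Fintype W] (φ : V → W)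
    (t : stdSimplex ℝ V) {w : W} (hw : stdSimplex.map φ t w ≠ 0) : ∃ v, t v ≠ 0 ∧ φ v = w := by
  rw [stdSimplex.map_coe, FunOnFinite.linearMap_apply_apply] at hw
  obtain ⟨v, hv, hne⟩ := Finset.exists_ne_zero_of_sum_ne_zero hw
  exact ⟨v, hne, (Finset.mem_filter.1 hv).2⟩

open scoped Classical in
/-- Contiguous simplicial maps have homotopic realizations. -/
theorem SimplicialMap.realize_homotopic {V : Type u} {W : Type v} [Fintype V] [Fintype W]
    {K : PreAbstractSimplicialComplex V} {L : PreAbstractSimplicialComplex W}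
    (φ ψ : SimplicialMap K L)
    (h : ∀ S ∈ K.faces, S.image φ.toFun ∪ S.image ψ.toFun ∈ L.faces) :
    φ.realize.Homotopic ψ.realize := by
  -- The straight-line homotopy; its support stays in the union of the two image simplices, which is
  -- a simplex by contiguity.
  let F : unitInterval × Realization K → stdSimplex ℝ W := fun q =>
    ⟨(1 - (q.1 : ℝ)) • (stdSimplex.map φ.toFun q.2.1 : stdSimplex ℝ W).1 +
      (q.1 : ℝ) • (stdSimplex.map ψ.toFun q.2.1 : stdSimplex ℝ W).1,
      convex_stdSimplex ℝ W (stdSimplex.map φ.toFun q.2.1).2 (stdSimplex.map ψ.toFun q.2.1).2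
        (sub_nonneg.2 q.1.2.2) q.1.2.1 (by ring)⟩
  have hF : ∀ q, Finset.univ.filter (fun w => F q w ≠ 0) ∈ L.faces := by
    intro q
    refine (L.isRelLowerSet_faces (h _ q.2.2)).2 ?_ ?_
    · intro w hw
      have hw' : (1 - (q.1 : ℝ)) * stdSimplex.map φ.toFun q.2.1 w +
        (q.1 : ℝ) * stdSimplex.map ψ.toFun q.2.1 w ≠ 0 := (Finset.mem_filter.1 hw).2
      simp only [Finset.mem_union, Finset.mem_image, Finset.mem_filter, Finset.mem_univ, true_and]
      by_cases h0 : stdSimplex.map φ.toFun q.2.1 w = 0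
      · refine Or.inr (exists_of_map_ne_zero ψ.toFun q.2.1 fun h1 => hw' ?_)
        rw [h0, h1]
        simp
      · exact Or.inl (exists_of_map_ne_zero φ.toFun q.2.1 h0)
    · by_contra hne
      rw [Finset.not_nonempty_iff_eq_empty, Finset.filter_eq_empty_iff] at hne
      have h1 : ∑ w, F q w = 1 := (F q).2.2
      rw [Finset.sum_eq_zero fun w hw => not_not.1 (hne hw)] at h1
      exact zero_ne_one h1
  have hc : Continuous F := by
    refine Continuous.subtype_mk ?_ _
    have h1 : ∀ χ : V → W, Continuous fun q : unitInterval × Realization K =>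
        (stdSimplex.map χ q.2.1 : stdSimplex ℝ W).1 := fun χ =>
      continuous_subtype_val.comp ((stdSimplex.continuous_map χ).comp
        (continuous_subtype_val.comp continuous_snd))
    have h2 : Continuous fun q : unitInterval × Realization K => (q.1 : ℝ) :=
      continuous_subtype_val.comp continuous_fst
    exact ((continuous_const.sub h2).smul (h1 _)).add (h2.smul (h1 _))
  exact ⟨{
    toFun := fun q => ⟨F q, hF q⟩
    continuous_toFun := hc.subtype_mk _
    map_zero_left := fun t => by
      refine Subtype.ext (Subtype.ext ?_)
      simp [F, SimplicialMap.realize]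
    map_one_left := fun t => by
      refine Subtype.ext (Subtype.ext ?_)
      simp [F, SimplicialMap.realize] }⟩

/-! ### Compositions of homotopy equivalences -/

theorem IsHomotopyInverse.comp {A B C : Type*} [TopologicalSpace A] [TopologicalSpace B]
    [TopologicalSpace C] {f : C(A, B)} {f' : C(B, A)} {g : C(B, C)} {g' : C(C, B)}
    (hf : IsHomotopyInverse f f') (hg : IsHomotopyInverse g g') :
    IsHomotopyInverse (g.comp f) (f'.comp g') := by
  constructor
  · have h : (f'.comp (g'.comp g)).comp f |>.Homotopic ((f'.comp (.id B)).comp f) :=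
      (ContinuousMap.Homotopic.refl f').comp hg.1 |>.comp (.refl f)
    exact h.trans hf.1
  · have h : (g.comp (f.comp f')).comp g' |>.Homotopic ((g.comp (.id B)).comp g') :=
      (ContinuousMap.Homotopic.refl g).comp hf.2 |>.comp (.refl g')
    exact h.trans hg.2

theorem IsHomotopyInverse.symm {A B : Type*} [TopologicalSpace A] [TopologicalSpace B]
    {f : C(A, B)} {g : C(B, A)} (h : IsHomotopyInverse f g) : IsHomotopyInverse g f :=
  ⟨h.2, h.1⟩

theorem IsHomotopyEquivalence.comp {A B C : Type*} [TopologicalSpace A] [TopologicalSpace B]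
    [TopologicalSpace C] {f : C(A, B)} {g : C(B, C)} (hg : IsHomotopyEquivalence g)
    (hf : IsHomotopyEquivalence f) : IsHomotopyEquivalence (g.comp f) := by
  obtain ⟨f', hf⟩ := hf
  obtain ⟨g', hg⟩ := hg
  exact ⟨_, hf.comp hg⟩

theorem IsHomotopyEquivalence.of_homotopic {A B : Type*} [TopologicalSpace A]
    [TopologicalSpace B] {f g : C(A, B)} (hf : IsHomotopyEquivalence f) (h : f.Homotopic g) :
    IsHomotopyEquivalence g := by
  obtain ⟨f', h1, h2⟩ := hf
  exact ⟨f', ((ContinuousMap.Homotopic.refl f').comp h.symm).trans h1,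
    (h.symm.comp (.refl f')).trans h2⟩

theorem IsSimpleHomotopyEquivalence.comp {U V W : Type u} [Fintype U] [Fintype V] [Fintype W]
    {K : PreAbstractSimplicialComplex U} {L : PreAbstractSimplicialComplex V}
    {M : PreAbstractSimplicialComplex W} {f : C(Realization K, Realization L)}
    {g : C(Realization L, Realization M)} (hg : IsSimpleHomotopyEquivalence g)
    (hf : IsSimpleHomotopyEquivalence f) : IsSimpleHomotopyEquivalence (g.comp f) := by
  obtain ⟨hf, d, hd, hfd⟩ := hf
  obtain ⟨hg, e, he, hge⟩ := hg
  exact ⟨hg.comp hf, _, .comp hd he, hge.comp hfd⟩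

theorem IsSimpleHomotopyEquivalence.of_homotopic {V W : Type u} [Fintype V] [Fintype W]
    {K : PreAbstractSimplicialComplex V} {L : PreAbstractSimplicialComplex W}
    {f g : C(Realization K, Realization L)} (hf : IsSimpleHomotopyEquivalence f)
    (h : f.Homotopic g) : IsSimpleHomotopyEquivalence g := by
  obtain ⟨hf, d, hd, hfd⟩ := hf
  exact ⟨hf.of_homotopic h, d, hd, h.symm.trans hfd⟩

/-! ### Continuous maps of finite spaces -/

theorem continuous_of_specializes {X : Type u} {Y : Type v} [Finite X] [TopologicalSpace X]
    [TopologicalSpace Y] {f : X → Y} (h : ∀ a b, a ⤳ b → f a ⤳ f b) : Continuous f :=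
  ⟨fun _ hU => isOpen_iff_forall_specializes.2 fun a b hab hb => (h a b hab).mem_open hU hb⟩

open scoped Classical in
/-- Maps that are pointwise comparable in the specialization preorder are homotopic. -/
theorem homotopic_of_specializes {X : Type u} {Y : Type v} [TopologicalSpace X]
    [TopologicalSpace Y] {f g : C(X, Y)} (h : ∀ x, f x ⤳ g x) : f.Homotopic g := by
  refine ⟨{
    toFun := fun q => if q.1 < 1 then f q.2 else g q.2
    continuous_toFun := ⟨fun U hU => ?_⟩
    map_zero_left := fun x => by simp
    map_one_left := fun x => by simp }⟩
  -- The homotopy is `f` before time `1` and `g` at time `1`. Since `f x ⤳ g x`, the preimage of `U`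
  -- under `g` lies in that under `f`, so the product with the whole interval may be used for `g`.
  have : (fun q : unitInterval × X => if q.1 < 1 then f q.2 else g q.2) ⁻¹' U =
      (Prod.snd ⁻¹' (g ⁻¹' U)) ∪ ((Prod.fst ⁻¹' Set.Iio 1) ∩ Prod.snd ⁻¹' (f ⁻¹' U)) := by
    ext ⟨s, x⟩
    by_cases hs : s < 1
    · simp only [Set.mem_preimage, hs, if_true, Set.mem_union, Set.mem_inter_iff, Set.mem_Iio,
        true_and]
      exact ⟨Or.inr, fun hx => hx.elim (fun hx => (h x).mem_open hU hx) id⟩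
    · simp [hs]
  rw [this]
  exact ((hU.preimage g.continuous).preimage continuous_snd).union
    ((isOpen_Iio.preimage continuous_fst).inter ((hU.preimage f.continuous).preimage continuous_snd))

/-- In a homotopy of maps from a finite space, the maps at nearby times specialize to the map at
the given time. -/
theorem eventually_specializes {X : Type u} {Y : Type v} [Finite X] [Finite Y]
    [TopologicalSpace X] [TopologicalSpace Y] {f g : C(X, Y)} (H : f.Homotopy g)
    (t : unitInterval) : ∀ᶠ s in nhds t, ∀ x, H (s, x) ⤳ H (t, x) := by
  refine Filter.eventually_all.2 fun x => ?_
  have hc : Continuous fun s => H (s, x) := by fun_prop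
  -- In a finite space `nhdsKer` of a point is its smallest open neighbourhood.
  filter_upwards [hc.continuousAt.preimage_mem_nhds
    (isOpen_nhdsKer.mem_nhds (subset_nhdsKer rfl) : nhdsKer {H (t, x)} ∈ nhds (H (t, x)))] with s hs
  simpa [mem_nhdsKer_iff_specializes] using hs

/-! ### Beat points -/

/-- `p` is the largest of the elements strictly below `x` for the relation `r`. -/
def IsGreatestBelow {X : Type u} (r : X → X → Prop) (x p : X) : Prop :=
  p ≠ x ∧ r p x ∧ ∀ y, y ≠ x → r y x → r y p

/-- `x` is a beat point, as witnessed by `p`: either `p` is the largest of the elements strictly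
below `x`, or it is the smallest of those strictly above. -/
def IsBeatPoint {X : Type u} [TopologicalSpace X] (x p : X) : Prop :=
  IsGreatestBelow (fun a b : X => a ⤳ b) x p ∨ IsGreatestBelow (fun a b : X => b ⤳ a) x p

/-- Induction along the strict relation: if `h` fixes everything strictly below `x` but moves `x`,
monotonicity makes `h x` the greatest element strictly below `x`. -/
theorem eq_self_of_forall_rel {X : Type u} [Finite X] (r : X → X → Prop) [IsTrans X r]
    [Std.Antisymm r] (hr : ∀ x p, ¬ IsGreatestBelow r x p) (h : X → X)
    (hmono : ∀ a b, r a b → r (h a) (h b)) (hle : ∀ x, r (h x) x) (x : X) : h x = x := by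
  have : IsTrans X (fun a b => r a b ∧ a ≠ b) := ⟨fun a b c hab hbc =>
    ⟨_root_.trans hab.1 hbc.1, by
      rintro rfl
      exact hab.2 (antisymm_of r hab.1 hbc.1)⟩⟩
  have : Std.Irrefl (fun a b : X => r a b ∧ a ≠ b) := ⟨fun a h => h.2 rfl⟩
  induction x using
    (Finite.wellFounded_of_trans_of_irrefl (fun a b : X => r a b ∧ a ≠ b)).induction with
  | _ x ih =>
  by_contra hx
  refine hr x (h x) ⟨hx, hle x, fun y hy hyx => ?_⟩
  have := hmono y x hyx
  rwa [ih y ⟨hyx, hy⟩] at this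

/-- The times at which the homotopy is the identity form a clopen subset of the connected unit
interval, containing `1`. Nearby maps are pointwise comparable, and without beat points a map
comparable with the identity equals it. -/
theorem eq_id_of_homotopic_id {X : Type u} [Finite X] [TopologicalSpace X] [T0Space X]
    (hX : ∀ x p : X, ¬ IsBeatPoint x p) {h : C(X, X)} (hh : h.Homotopic (ContinuousMap.id X)) :
    h = ContinuousMap.id X := by
  have : IsTrans X (fun a b => a ⤳ b) := ⟨fun _ _ _ => Specializes.trans⟩
  have : IsTrans X (fun a b => b ⤳ a) := ⟨fun _ _ _ h1 h2 => h2.trans h1⟩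
  have : Std.Antisymm (fun a b : X => a ⤳ b) := ⟨fun _ _ h1 h2 => (h1.antisymm h2).eq⟩
  have : Std.Antisymm (fun a b : X => b ⤳ a) := ⟨fun _ _ h1 h2 => (h2.antisymm h1).eq⟩
  have below : ∀ k : C(X, X), (∀ x, k x ⤳ x) → ∀ x, k x = x := fun k =>
    eq_self_of_forall_rel (fun a b => a ⤳ b) (fun x p hp => hX x p (Or.inl hp)) k
      (fun _ _ hab => hab.map k.continuous)
  have above : ∀ k : C(X, X), (∀ x, x ⤳ k x) → ∀ x, k x = x := fun k =>
    eq_self_of_forall_rel (fun a b => b ⤳ a) (fun x p hp => hX x p (Or.inr hp)) k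
      (fun _ _ hab => hab.map k.continuous)
  obtain ⟨H⟩ := hh
  have hclopen : IsClopen {t : unitInterval | ∀ x, H (t, x) = x} := by
    constructor
    · refine isOpen_compl_iff.1 (isOpen_iff_mem_nhds.2 fun t ht => ?_)
      filter_upwards [eventually_specializes H t] with s hs hs'
      refine ht (above (H.curry t) fun x => ?_)
      have := hs x
      rwa [hs' x] at this
    · refine isOpen_iff_mem_nhds.2 fun t ht => ?_
      filter_upwards [eventually_specializes H t] with s hs
      refine below (H.curry s) fun x => ?_
      have := hs x
      rwa [ht x] at this
  have h0 : (0 : unitInterval) ∈ {t : unitInterval | ∀ x, H (t, x) = x} := by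
    rw [hclopen.eq_univ ⟨1, fun x => by simp⟩]
    trivial
  ext x
  simpa using h0 x

/-! ### Removing a beat point -/

section Removal

variable {X : Type u} [TopologicalSpace X] {x p : X}

theorem IsBeatPoint.ne (h : IsBeatPoint x p) : p ≠ x := h.elim (fun h => h.1) (fun h => h.1)

/-- The inclusion of the complement of a point. -/
def inclusion (x : X) : C({y : X // y ≠ x}, X) := ⟨Subtype.val, continuous_subtype_val⟩

open scoped Classical in
/-- The retraction onto the complement of a beat point `x` that maps `x` to `p`. -/
noncomputable def IsBeatPoint.retraction [Finite X] (h : IsBeatPoint x p) :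
    C(X, {y : X // y ≠ x}) where
  toFun y := if hy : y = x then ⟨p, h.ne⟩ else ⟨y, hy⟩
  continuous_toFun := continuous_of_specializes fun a b hab => by
    rw [subtype_specializes_iff]
    -- Pairs involving `x` need either transitivity through `x` or the extremality of `p`.
    rcases h with ⟨hne, hp, hy⟩ | ⟨hne, hp, hy⟩
    · by_cases ha : a = x
      · subst ha
        by_cases hb : b = a
        · simp [hb, specializes_rfl]
        · simpa [hb] using hp.trans hab
      · by_cases hb : b = x
        · subst hb
          simpa [ha] using hy a ha hab
        · simpa [ha, hb] using hab
    · by_cases ha : a = x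
      · subst ha
        by_cases hb : b = a
        · simp [hb, specializes_rfl]
        · simpa [hb] using hy b hb hab
      · by_cases hb : b = x
        · subst hb
          simpa [ha] using hab.trans hp
        · simpa [ha, hb] using hab

-- This is the cone condition on the link of `x` required by `collapses_deletion`.
open scoped Classical in
theorem IsBeatPoint.insert_mem_faces (h : IsBeatPoint x p) {S : Finset X}
    (hS : S ∈ (orderComplex X).faces) (hx : x ∈ S) : insert p S ∈ (orderComplex X).faces := by
  refine ⟨Finset.insert_nonempty _ _, ?_⟩
  rw [Finset.coe_insert]
  refine hS.2.insert fun y hy _ => ?_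
  rcases h with ⟨hne, hp, hmax⟩ | ⟨hne, hp, hmax⟩
  · rcases eq_or_ne y x with rfl | hyx
    · exact Or.inl hp
    · rcases hS.2 hy hx hyx with h1 | h1
      · exact Or.inr (hmax y hyx h1)
      · exact Or.inl (hp.trans h1)
  · rcases eq_or_ne y x with rfl | hyx
    · exact Or.inr hp
    · rcases hS.2 hy hx hyx with h1 | h1
      · exact Or.inr (h1.trans hp)
      · exact Or.inl (hmax y hyx h1)

open scoped Classical in
theorem map_inclusion (x : X) :
    (orderComplex {y : X // y ≠ x}).map (inclusion x) = deletion (orderComplex X) x := by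
  ext T
  constructor
  · rintro ⟨S, hS, rfl⟩
    refine ⟨(orderComplexMap (inclusion x)).image_mem S hS, fun hx => ?_⟩
    obtain ⟨y, -, hy⟩ := Finset.mem_image.1 hx
    exact y.2 hy
  · rintro ⟨⟨hne, hT⟩, hx⟩
    have himg : (T.subtype (fun y => y ≠ x)).image (inclusion x) = T := by
      ext y
      simp only [Finset.mem_image, Finset.mem_subtype]
      exact ⟨fun ⟨z, hz, h⟩ => h ▸ hz, fun hy => ⟨⟨y, fun h => hx (h ▸ hy)⟩, hy, rfl⟩⟩
    refine ⟨T.subtype (fun y => y ≠ x), ⟨?_, ?_⟩, himg⟩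
    · exact Finset.image_nonempty.1 (himg.symm ▸ hne)
    · intro a ha b hb hab
      simp only [Finset.mem_coe, Finset.mem_subtype] at ha hb
      simp only [subtype_specializes_iff]
      exact hT ha hb (fun h => hab (Subtype.ext h))

variable [Finite X]

theorem IsBeatPoint.retraction_self (h : IsBeatPoint x p) : (h.retraction x : X) = p := by
  simp [IsBeatPoint.retraction]

theorem IsBeatPoint.retraction_of_ne (h : IsBeatPoint x p) {y : X} (hy : y ≠ x) :
    (h.retraction y : X) = y := by
  simp [IsBeatPoint.retraction, hy]

theorem IsBeatPoint.retraction_comp_inclusion (h : IsBeatPoint x p) :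
    h.retraction.comp (inclusion x) = ContinuousMap.id _ := by
  ext y
  exact h.retraction_of_ne y.2

theorem IsBeatPoint.isHomotopyInverse (h : IsBeatPoint x p) :
    IsHomotopyInverse (inclusion x) h.retraction := by
  refine ⟨by rw [h.retraction_comp_inclusion], ?_⟩
  -- Keeping `r` arbitrary treats beat points with `p` below and with `p` above `x` together.
  have key : ∀ r : X → X → Prop, (∀ y, r y y) → r p x →
      ∀ y, r ((inclusion x).comp h.retraction y) y := by
    intro r hr hpx y
    by_cases hy : y = x
    · subst hy
      change r (h.retraction y : X) y
      rwa [h.retraction_self]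
    · change r (h.retraction y : X) y
      rw [h.retraction_of_ne hy]
      exact hr y
  rcases h with h' | h'
  · exact homotopic_of_specializes (key _ (fun _ => specializes_rfl) h'.2.1)
  · exact (homotopic_of_specializes (key (fun a b => b ⤳ a) (fun _ => specializes_rfl) h'.2.1)).symm

theorem IsBeatPoint.isExpansion (h : IsBeatPoint x p) :
    (orderComplexMap (inclusion x)).IsExpansion := by
  classical
  refine ⟨Subtype.val_injective.injOn, ?_⟩
  have := collapses_deletion (orderComplex X) h.ne fun S hS hx => h.insert_mem_faces hS hx
  rw [← map_inclusion] at this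
  exact this

end Removal

theorem realize_comp {X Y Z : Type u} [Fintype X] [Fintype Y] [Fintype Z] [TopologicalSpace X]
    [TopologicalSpace Y] [TopologicalSpace Z] (g : C(Y, Z)) (f : C(X, Y)) :
    (orderComplexMap (g.comp f)).realize =
      (orderComplexMap g).realize.comp (orderComplexMap f).realize := by
  refine ContinuousMap.ext fun t => Subtype.ext ?_
  exact (stdSimplex.map_comp_apply f g t.1).symm

theorem realize_id (X : Type u) [Fintype X] [TopologicalSpace X] :
    (orderComplexMap (ContinuousMap.id X)).realize = ContinuousMap.id _ :=
  ContinuousMap.ext fun t => Subtype.ext (stdSimplex.map_id_apply t.1)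

/-- The retraction followed by the inclusion is contiguous to the identity: a chain and its image
lie in the chain itself, or in the chain with `p` added if it contains `x`. -/
theorem IsBeatPoint.realize_isHomotopyInverse {X : Type u} [Fintype X] [TopologicalSpace X]
    {x p : X} [Fintype {y : X // y ≠ x}] (h : IsBeatPoint x p) :
    IsHomotopyInverse (orderComplexMap (inclusion x)).realize
      (orderComplexMap h.retraction).realize := by
  classical
  constructor
  · rw [← realize_comp, h.retraction_comp_inclusion, realize_id]
  · rw [← realize_comp, ← realize_id]
    refine SimplicialMap.realize_homotopic _ _ fun S hS => ?_
    have hsub : ∀ T : Finset X, S ⊆ T → (∀ y ∈ S, (h.retraction y : X) ∈ T) →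
        S.image (orderComplexMap ((inclusion x).comp h.retraction)).toFun ∪
          S.image (orderComplexMap (ContinuousMap.id X)).toFun ⊆ T := by
      intro T hST hT
      refine Finset.union_subset (Finset.image_subset_iff.2 hT) (Finset.image_subset_iff.2 hST)
    have hne : (S.image (orderComplexMap ((inclusion x).comp h.retraction)).toFun ∪
          S.image (orderComplexMap (ContinuousMap.id X)).toFun).Nonempty :=
      (hS.1.image _).mono Finset.subset_union_left
    by_cases hx : x ∈ S
    · refine ((orderComplex X).isRelLowerSet_faces (h.insert_mem_faces hS hx)).2
        (hsub _ (Finset.subset_insert _ _) fun y hy => ?_) hne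
      rcases eq_or_ne y x with rfl | hyx
      · rw [h.retraction_self]
        exact Finset.mem_insert_self _ _
      · rw [h.retraction_of_ne hyx]
        exact Finset.mem_insert_of_mem hy
    · refine ((orderComplex X).isRelLowerSet_faces hS).2 (hsub _ subset_rfl fun y hy => ?_) hne
      rw [h.retraction_of_ne (fun h => hx (h ▸ hy))]
      exact hy

theorem isSimple_inclusion {X : Type u} [Fintype X] [TopologicalSpace X]
    {x p : X} [Fintype {y : X // y ≠ x}] (h : IsBeatPoint x p) :
    IsSimpleHomotopyEquivalence (orderComplexMap (inclusion x)).realize :=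
  ⟨⟨_, h.realize_isHomotopyInverse⟩, _, .expansion _ h.isExpansion, .refl _⟩

theorem isSimple_retraction {X : Type u} [Fintype X] [TopologicalSpace X]
    {x p : X} [Fintype {y : X // y ≠ x}] (h : IsBeatPoint x p) :
    IsSimpleHomotopyEquivalence (orderComplexMap h.retraction).realize :=
  ⟨⟨_, h.realize_isHomotopyInverse.symm⟩, _,
    .homotopyInverse _ h.isExpansion _ h.realize_isHomotopyInverse, .refl _⟩

/-- A homeomorphism of finite spaces induces a simple homotopy equivalence. -/
theorem isSimple_of_inverse {X Y : Type u} [Fintype X] [Fintype Y] [TopologicalSpace X]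
    [TopologicalSpace Y] {f : C(X, Y)} {g : C(Y, X)} (hgf : g.comp f = ContinuousMap.id X)
    (hfg : f.comp g = ContinuousMap.id Y) :
    IsSimpleHomotopyEquivalence (orderComplexMap f).realize := by
  classical
  have hexp : (orderComplexMap f).IsExpansion := by
    have hl : Function.LeftInverse g f := fun x => DFunLike.congr_fun hgf x
    have hr : Function.RightInverse g f := fun y => DFunLike.congr_fun hfg y
    refine ⟨hl.injective.injOn, ?_⟩
    have : (orderComplex X).map f = orderComplex Y := by
      ext T
      constructor
      · rintro ⟨S, hS, rfl⟩
        exact (orderComplexMap f).image_mem S hS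
      · intro hT
        refine ⟨T.image g, (orderComplexMap g).image_mem T hT, ?_⟩
        simp only [Finset.image_image, hr.comp_eq_id, Finset.image_id]
    have h2 : Collapses (orderComplex Y) ((orderComplex X).map f) := by
      rw [this]
      exact Relation.ReflTransGen.refl
    exact h2
  refine ⟨⟨(orderComplexMap g).realize, ?_, ?_⟩, _, .expansion _ hexp, .refl _⟩
  · rw [← realize_comp, hgf, realize_id]
  · rw [← realize_comp, hfg, realize_id]

/-- Induction on the total number of points, so that a beat point may be removed from either space.
-/
theorem isSimple_of_card {X Y : Type u} [Fintype X] [Fintype Y] [TopologicalSpace X]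
    [TopologicalSpace Y] [T0Space X] [T0Space Y] (f : C(X, Y)) (hf : IsHomotopyEquivalence f)
    (n : ℕ) (hn : Fintype.card X + Fintype.card Y = n) :
    IsSimpleHomotopyEquivalence (orderComplexMap f).realize := by
  classical
  induction n using Nat.strong_induction_on generalizing X Y with
  | _ n ih =>
  by_cases hX : ∃ x p : X, IsBeatPoint x p
  · obtain ⟨x, p, h⟩ := hX
    have hcard : Fintype.card {y : X // y ≠ x} < Fintype.card X :=
      Fintype.card_subtype_lt (x := x) (by simp)
    have hs := ih _ (by omega) (f.comp (inclusion x))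
      (hf.comp ⟨_, h.isHomotopyInverse⟩) rfl
    rw [realize_comp] at hs
    have hs' := hs.comp (isSimple_retraction h)
    rw [ContinuousMap.comp_assoc] at hs'
    -- Inserting the retraction followed by the inclusion before `f` does not change the homotopy
    -- class of its realization.
    have hh := (ContinuousMap.Homotopic.refl (orderComplexMap f).realize).comp
      h.realize_isHomotopyInverse.2
    rw [ContinuousMap.comp_id] at hh
    exact hs'.of_homotopic hh
  by_cases hY : ∃ y p : Y, IsBeatPoint y p
  · obtain ⟨y, p, h⟩ := hY
    have hcard : Fintype.card {z : Y // z ≠ y} < Fintype.card Y :=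
      Fintype.card_subtype_lt (x := y) (by simp)
    have hs := ih _ (by omega) (h.retraction.comp f)
      (IsHomotopyEquivalence.comp ⟨inclusion y, h.isHomotopyInverse.symm⟩ hf) rfl
    rw [realize_comp] at hs
    have hs' := (isSimple_inclusion h).comp hs
    rw [← ContinuousMap.comp_assoc] at hs'
    have hh := h.realize_isHomotopyInverse.2.comp (.refl (orderComplexMap f).realize)
    rw [ContinuousMap.id_comp] at hh
    exact hs'.of_homotopic hh
  push Not at hX hY
  obtain ⟨g, hgf, hfg⟩ := hf
  -- Both composites with the homotopy inverse are homotopic to identities, hence equal to them.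
  exact isSimple_of_inverse (eq_id_of_homotopic_id hX hgf) (eq_id_of_homotopic_id hY hfg)

end SimpleHomotopy

theorem mainTheorem5 {X Y : Type u} [Fintype X] [Fintype Y] [TopologicalSpace X]
    [TopologicalSpace Y] [T0Space X] [T0Space Y] (f : C(X, Y))
    (hf : SimpleHomotopy.IsHomotopyEquivalence f) :
    SimpleHomotopy.IsSimpleHomotopyEquivalence (SimpleHomotopy.orderComplexMap f).realize := by
  exact SimpleHomotopy.isSimple_of_card f hf _ rfl
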